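/- Let $G$ be a simple graph that is connected, locally finite (every vertex has finite degree; $G$ may be infinite) and chordal (it contains no induced cycle of length greater than $3$). A clique of $G$ is an inclusion-maximal complete set of vertices. The clique graph $\mathcal{K}_G$ has the cliques of $G$ as its vertices, two distinct cliques being adjacent when they intersect. For a complete (possibly empty) set $C$ of vertices, the clique family generated by $C$ is $F(C)=\{K \text{ clique of } G : C\subseteq K\}$; a clique family is a set of the form $F(C)$. A spanning tree $T$ of $\mathcal{K}_G$ is a clique tree of $G$ if, for every vertex $v$ of $G$, the subgraph $T[F(\{v\})]$ of $T$ induced by the cliques containing $v$ is a tree. For a finite set $F$ of cliques and a spanning tree $S$ of the induced subgraph $\mathcal{K}_G[F]$, put $w(S)=\sum_{K_1K_2\in S}|K_1\cap K_2|$, the sum being over the edges of $S$. **Theorem.** Let $T$ be a spanning tree of $\mathcal{K}_G$. Then $T$ is a clique tree of $G$ if and only if, for every finite clique family $F$ of $G$, the induced subgraph $T[F]$ is a spanning tree of $\mathcal{K}_G[F]$ of maximum weight, i.e. $T[F]$ is a spanning tree of $\mathcal{K}_G[F]$ and $w(S)\le w(T[F])$ for every spanning tree $S$ of $\mathcal{K}_G[F]$.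 -/

import Mathlib

namespace CliqueTree

variable {V : Type*}

/-- A graph is chordal if it contains no induced cycle of length greater than three. -/
def IsChordal (G : SimpleGraph V) : Prop :=
  ∀ n : ℕ, 4 ≤ n → IsEmpty (SimpleGraph.cycleGraph n ↪g G)

/-- The cliques of `G`: the inclusion-maximal complete sets of vertices. -/
abbrev Cliques (G : SimpleGraph V) : Type _ :=
  {K : Set V // Maximal G.IsClique K}

/-- The clique graph of `G`: its vertices are the cliques of `G`, and two distinct cliques are
adjacent if they have a common vertex. -/
def cliqueGraph (G : SimpleGraph V) : SimpleGraph (Cliques G) where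
  Adj K₁ K₂ := K₁ ≠ K₂ ∧ (K₁.1 ∩ K₂.1).Nonempty
  symm := ⟨fun K₁ K₂ h => ⟨h.1.symm, by rw [Set.inter_comm]; exact h.2⟩⟩
  loopless := ⟨fun _ h => h.1 rfl⟩

/-- `T` is a spanning tree of `H`. -/
def IsSpanningTree {W : Type*} (H T : SimpleGraph W) : Prop :=
  T ≤ H ∧ T.IsTree

/-- The clique family generated by a set of vertices: all cliques that contain the set. -/
def family (G : SimpleGraph V) (C : Set V) : Set (Cliques G) :=
  {K | C ⊆ K.1}

/-- `F` is a clique family: it is generated by some (possibly empty) complete set of vertices. -/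
def IsCliqueFamily (G : SimpleGraph V) (F : Set (Cliques G)) : Prop :=
  ∃ C : Set V, G.IsClique C ∧ F = family G C

/-- `T` is a clique tree of `G`: a spanning tree of the clique graph that induces a tree on the
set of cliques containing `v`, for every vertex `v`. -/
def IsCliqueTree (G : SimpleGraph V) (T : SimpleGraph (Cliques G)) : Prop :=
  IsSpanningTree (cliqueGraph G) T ∧ ∀ v : V, (T.induce (family G {v})).IsTree

/-- The weight `|K₁ ∩ K₂|` of a pair of cliques; cliques of a locally finite graph are finite. -/
noncomputable def edgeWeight (G : SimpleGraph V) : Sym2 (Cliques G) → ℕ :=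
  Sym2.lift ⟨fun K₁ K₂ => (K₁.1 ∩ K₂.1).ncard, fun K₁ K₂ => by
    simp only [Set.inter_comm]⟩

/-- The weight of a graph on a set `F` of cliques: the sum of the weights of its edges.
It is used only for finite `F`, where the sum is finite. -/
noncomputable def weight (G : SimpleGraph V) {F : Set (Cliques G)} (S : SimpleGraph F) : ℕ :=
  ∑ᶠ e ∈ S.edgeSet, edgeWeight G (e.map Subtype.val)

/-- `S` is a spanning tree of the clique graph restricted to `F`, of maximum weight among all
such spanning trees. -/
def IsMaxWeightSpanningTree (G : SimpleGraph V) (F : Set (Cliques G)) (S : SimpleGraph F) :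
    Prop :=
  IsSpanningTree ((cliqueGraph G).induce F) S ∧
    ∀ S' : SimpleGraph F, IsSpanningTree ((cliqueGraph G).induce F) S' →
      weight G S' ≤ weight G S

end CliqueTree

namespace CliqueTree

open SimpleGraph

section Forests

variable {W : Type*}

/-! Double counting turns the weight of `S` into a sum over vertices `v` of the number of edges of
`S` joining cliques that contain `v` (`weight_eq_sum`). For a forest each term is at most the number
of such cliques minus one, with equality for a tree, so inducing a tree at every `v` maximises all
terms at once (`weight_le_of_isAcyclic`). In a clique tree, the path from `K` to `L` stays among
cliques containing `K ∩ L`; hence it stays inside any clique family containing both ends, and `T[F]`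
meets this criterion. Conversely, `F({v})` is a finite clique family, and the hypothesis for it says
in particular that `T` induces a tree there. -/

lemma ncard_edgeSet_add_one_of_isTree [Finite W] {S : SimpleGraph W} (hS : S.IsTree) :
    S.edgeSet.ncard + 1 = Nat.card W := by
  simpa using! (isTree_iff_connected_and_card.1 hS).2

lemma ncard_edgeSet_add_one_le_of_isAcyclic [Finite W] [Nonempty W] {S : SimpleGraph W}
    (hS : S.IsAcyclic) : S.edgeSet.ncard + 1 ≤ Nat.card W := by
  -- A forest extends to a spanning tree of the complete graph.
  obtain ⟨T, hST, -, hT⟩ :=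
    (connected_top (V := W)).exists_isTree_le_of_le_of_isAcyclic le_top hS
  rw [← ncard_edgeSet_add_one_of_isTree hT]
  gcongr
  exact Set.toFinite _

/-- The edges of an induced subgraph correspond to the edges with both ends in the vertex set. -/
lemma ncard_edgeSet_induce (S : SimpleGraph W) (A : Set W) :
    (S.induce A).edgeSet.ncard = {e | e ∈ S.edgeSet ∧ ∀ K ∈ e, K ∈ A}.ncard := by
  rw [← Set.ncard_image_of_injective _ (Sym2.map.injective (Subtype.val_injective (p := (· ∈ A))))]
  congr 1
  ext e
  constructor
  · rintro ⟨e, he, rfl⟩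
    induction e with | _ a b
    simpa using he
  · induction e with | _ a b
    rintro ⟨he, hA⟩
    refine ⟨s(⟨a, hA a (by simp)⟩, ⟨b, hA b (by simp)⟩), by simpa using he, by simp⟩

/-- Two vertices of a tree that are joined within a set of vertices are joined within it by
their unique path. -/
lemma support_subset_of_induce_preconnected {T : SimpleGraph W} (hT : T.IsAcyclic) {A : Set W}
    (hA : (T.induce A).Preconnected) {a b : W} (ha : a ∈ A) (hb : b ∈ A) {p : T.Walk a b}
    (hp : p.IsPath) : ∀ x ∈ p.support, x ∈ A := by
  classical
  obtain ⟨q⟩ := hA ⟨a, ha⟩ ⟨b, hb⟩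
  let r : T.Walk a b := q.map (Embedding.induce A).toHom
  have hpr : p = r.bypass := congrArg Subtype.val
    ((hT.subsingleton_path a b).elim ⟨p, hp⟩ ⟨r.bypass, r.bypass_isPath⟩)
  intro x hx
  rw [hpr] at hx
  have hx' : x ∈ q.support.map (Embedding.induce A).toHom :=
    Walk.support_map (Embedding.induce A).toHom q ▸ r.support_bypass_subset_support hx
  obtain ⟨y, -, rfl⟩ := List.mem_map.1 hx'
  exact y.2

end Forests

variable {V : Type*} {G : SimpleGraph V}

lemma finite_insert_neighborSet (hlf : ∀ v : V, (G.neighborSet v).Finite) (v : V) :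
    (insert v (G.neighborSet v)).Finite :=
  (hlf v).insert v

lemma subset_insert_neighborSet {K : Set V} (hK : G.IsClique K) {v : V} (hv : v ∈ K) :
    K ⊆ insert v (G.neighborSet v) := by
  intro w hw
  by_cases h : w = v
  · exact Or.inl h
  · exact Or.inr (hK hv hw (Ne.symm h))

lemma finite_of_isClique (hlf : ∀ v : V, (G.neighborSet v).Finite) {K : Set V}
    (hK : G.IsClique K) : K.Finite := by
  obtain rfl | ⟨v, hv⟩ := K.eq_empty_or_nonempty
  · exact Set.finite_empty
  · exact (finite_insert_neighborSet hlf v).subset (subset_insert_neighborSet hK hv)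

/-- Every clique through `v` is a subset of the finite closed neighbourhood of `v`. -/
lemma finite_family_singleton (hlf : ∀ v : V, (G.neighborSet v).Finite) (v : V) :
    (family G {v}).Finite := by
  refine Set.Finite.of_finite_image (f := Subtype.val) ?_ Subtype.val_injective.injOn
  refine (finite_insert_neighborSet hlf v).finite_subsets.subset ?_
  rintro _ ⟨K, hK, rfl⟩
  exact subset_insert_neighborSet K.2.prop (hK rfl)

/-- Zorn's lemma, as the union of a chain of complete sets is complete. A tree needs a vertex, so
this is required for `T[F]`. -/
lemma family_nonempty {C : Set V} (hC : G.IsClique C) : (family G C).Nonempty := by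
  obtain ⟨K, hCK, hK⟩ := zorn_subset_nonempty {K | G.IsClique K} (fun c hc hchain _ => by
    refine ⟨⋃₀ c, ?_, fun s hs => Set.subset_sUnion_of_mem hs⟩
    exact (Set.pairwise_sUnion hchain.directedOn).2 fun s hs => hc hs) C hC
  exact ⟨⟨K, hK⟩, hCK⟩

open scoped Classical in
lemma edgeWeight_eq_sum {U : Finset V} (e : Sym2 (Cliques G)) (hU : ∀ K ∈ e, K.1 ⊆ U) :
    edgeWeight G e = ∑ v ∈ U, if ∀ K ∈ e, v ∈ K.1 then 1 else 0 := by
  induction e with | _ K L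
  have : K.1 ∩ L.1 = ↑(U.filter fun v => v ∈ K.1 ∧ v ∈ L.1) := by
    ext v
    have := @hU K (by simp) v
    simp only [Finset.coe_filter, Set.mem_inter_iff, Set.mem_ofPred_eq]
    exact ⟨fun h => ⟨this h.1, h⟩, fun h => h.2⟩
  change (K.1 ∩ L.1).ncard = _
  rw [this, Set.ncard_coe_finset, Finset.card_filter]
  refine Finset.sum_congr rfl fun v _ => ?_
  have : (∀ M ∈ s(K, L), v ∈ M.1) ↔ v ∈ K.1 ∧ v ∈ L.1 :=
    Sym2.ball (p := fun M : Cliques G => v ∈ M.1)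
  simp only [this]

/-- Counting the weight of a graph on cliques vertex by vertex. -/
lemma weight_eq_sum {F : Set (Cliques G)} [Finite F] {U : Finset V}
    (hU : ∀ K ∈ F, K.1 ⊆ U) (S : SimpleGraph F) :
    weight G S = ∑ v ∈ U, (S.induce {K | v ∈ K.1.1}).edgeSet.ncard := by
  classical
  have hS : S.edgeSet.Finite := Set.toFinite _
  rw [weight, finsum_mem_eq_finite_toFinset_sum _ hS]
  have h : ∀ e ∈ hS.toFinset, edgeWeight G (e.map Subtype.val) =
      ∑ v ∈ U, if ∀ K ∈ e, v ∈ K.1.1 then 1 else 0 := fun e _ => by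
    rw [edgeWeight_eq_sum (U := U)]
    · simp only [Sym2.mem_map, forall_exists_index, and_imp, forall_apply_eq_imp_iff₂]
    · intro K hK
      obtain ⟨L, -, rfl⟩ := Sym2.mem_map.1 hK
      exact hU _ L.2
  rw [Finset.sum_congr rfl h, Finset.sum_comm]
  refine Finset.sum_congr rfl fun v _ => ?_
  rw [← Finset.card_filter, ncard_edgeSet_induce, ← Set.ncard_coe_finset]
  simp

/-- A graph on a finite set of cliques has maximum weight among forests if, for every vertex, it
induces a tree on the cliques containing that vertex. -/
lemma weight_le_of_isAcyclic (hlf : ∀ v : V, (G.neighborSet v).Finite) {F : Set (Cliques G)}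
    [Finite F] {S S' : SimpleGraph F} (hS' : S'.IsAcyclic)
    (hS : ∀ v, {K : F | v ∈ K.1.1}.Nonempty → (S.induce {K | v ∈ K.1.1}).IsTree) :
    weight G S' ≤ weight G S := by
  have hfin : (⋃ K : F, K.1.1).Finite :=
    Set.finite_iUnion fun K => finite_of_isClique hlf K.1.2.prop
  have hU : ∀ K ∈ F, K.1 ⊆ hfin.toFinset := fun K hK => by
    rw [hfin.coe_toFinset]
    exact Set.subset_iUnion (fun K : F => K.1.1) ⟨K, hK⟩
  rw [weight_eq_sum hU, weight_eq_sum hU]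
  refine Finset.sum_le_sum fun v hv => ?_
  -- The bound on the edges of a forest needs at least one vertex; each `v` in the union lies in
  -- some clique of `F`.
  have hne : {K : F | v ∈ K.1.1}.Nonempty := by simpa [Set.Nonempty] using hv
  have := hne.to_subtype
  have h₁ := ncard_edgeSet_add_one_of_isTree (hS v hne)
  have h₂ := ncard_edgeSet_add_one_le_of_isAcyclic (hS'.induce {K | v ∈ K.1.1})
  lia

variable {T : SimpleGraph (Cliques G)}

/-- The path between two cliques in a clique tree runs through cliques that contain their
intersection. -/
lemma IsCliqueTree.inter_subset_of_mem_support (h : IsCliqueTree G T) {K L : Cliques G}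
    {p : T.Walk K L} (hp : p.IsPath) {M : Cliques G} (hM : M ∈ p.support) :
    K.1 ∩ L.1 ⊆ M.1 := by
  intro v hv
  simpa [family] using support_subset_of_induce_preconnected h.1.2.isAcyclic
    (h.2 v).connected.preconnected (by simpa [family] using hv.1) (by simpa [family] using hv.2)
    hp M hM

lemma IsCliqueTree.isMaxWeightSpanningTree (h : IsCliqueTree G T)
    (hlf : ∀ v : V, (G.neighborSet v).Finite) {C : Set V} (hC : G.IsClique C)
    (hfin : (family G C).Finite) :
    IsMaxWeightSpanningTree G (family G C) (T.induce (family G C)) := by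
  have hpath := fun K L => (h.1.2.existsUnique_path K L).exists
  have hmem : ∀ {K L : Cliques G} (p : T.Walk K L), p.IsPath → K ∈ family G C →
      L ∈ family G C → ∀ M ∈ p.support, M ∈ family G C := fun p hp hK hL M hM =>
    (Set.subset_inter hK hL).trans (h.inter_subset_of_mem_support hp hM)
  have : Finite (family G C) := hfin
  refine ⟨⟨fun _ _ hab => h.1.1 hab, ⟨?_, h.1.2.isAcyclic.induce _⟩⟩, fun S' hS' =>
    weight_le_of_isAcyclic hlf hS'.2.isAcyclic fun v hv => ⟨?_, ?_⟩⟩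
  · have := (family_nonempty hC).to_subtype
    refine ⟨fun K L => ?_⟩
    obtain ⟨p, hp⟩ := hpath K.1 L.1
    exact ⟨p.induce _ (hmem p hp K.2 L.2)⟩
  · have := hv.to_subtype
    refine ⟨fun K L => ?_⟩
    obtain ⟨p, hp⟩ := hpath K.1.1 L.1.1
    -- The path in `T` is restricted twice: to the family, then to its cliques containing `v`.
    refine ⟨(p.induce _ (hmem p hp K.1.2 L.1.2)).induce _ fun M hM => ?_⟩
    rw [Walk.support_induce, List.mem_attachWith] at hM
    exact h.inter_subset_of_mem_support hp hM ⟨K.2, L.2⟩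
  · exact (h.1.2.isAcyclic.induce _).induce _

end CliqueTree

theorem mainTheorem10 {V : Type*} (G : SimpleGraph V)
    (hconn : G.Connected) (hlf : ∀ v : V, (G.neighborSet v).Finite)
    (hchordal : CliqueTree.IsChordal G)
    (T : SimpleGraph (CliqueTree.Cliques G))
    (hT : CliqueTree.IsSpanningTree (CliqueTree.cliqueGraph G) T) :
    CliqueTree.IsCliqueTree G T ↔
      ∀ F : Set (CliqueTree.Cliques G), CliqueTree.IsCliqueFamily G F → F.Finite →
        CliqueTree.IsMaxWeightSpanningTree G F (T.induce F) := by
  refine ⟨fun h F hF hfin => ?_, fun h => ⟨hT, fun v => ?_⟩⟩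
  · obtain ⟨C, hC, rfl⟩ := hF
    exact h.isMaxWeightSpanningTree hlf hC hfin
  · exact (h _ ⟨{v}, by simp, rfl⟩ (CliqueTree.finite_family_singleton hlf v)).1.2
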